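/- Let $p,q\ge 0$ be integers and $n=p+q$. A $(p,q)$-clan is an involution of $\{1,\dots,n\}$ (an element $\sigma\in S_n$ with $\sigma^2=1$) each of whose fixed points is decorated by a sign $+$ or $-$, such that the number of $+$ signs minus the number of $-$ signs is $p-q$. It is written as a string $c_1\cdots c_n$, where $c_i$ is the sign of $i$ if $i$ is fixed, and where $c_i=c_j\in\mathbb N$ is a pair of matching natural numbers if the involution interchanges $i\neq j$ (a different number for each such pair; the choice of the numbers is immaterial). For a clan $\gamma=c_1\cdots c_n$ let - $\gamma(i;+)$, respectively $\gamma(i;-)$, be the number of $+$ signs, respectively $-$ signs, among $c_1,\dots,c_i$ plus the number of pairs of equal natural numbers occurring among $c_1,\dots,c_i$ ($1\le i\le n$); - $\gamma(i;j)$ be the number of pairs of equal natural numbers $c_s=c_t$ with $s\le i<j<t$ ($1\le i<j\le n$). The combinatorial Bruhat order on $(p,q)$-clans is defined by: $\gamma\le\tau$ if and only if $\gamma(i;+)\ge\tau(i;+)$ and $\gamma(i;-)\ge\tau(i;-)$ for all $i$, and $\gamma(i;j)\le\tau(i;j)$ for all $i<j$. Write $\gamma<\tau$ if $\gamma\le\tau$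 and $\gamma\ne\tau$. **Theorem.** Let $\gamma,\tau$ be $(p,q)$-clans with $\gamma<\tau$. Then there is a $(p,q)$-clan $\gamma'$ with $\gamma<\gamma'\le\tau$ which is obtained from $\gamma$ by one of the following ten moves, in each of which the symbols of $\gamma$ at some positions $i_1<i_2<\cdots$ (not necessarily consecutive) form the pattern on the left and are replaced by the pattern on the right, all other symbols being unchanged (in a pattern, equal numbers stand for a pair of matching natural numbers, and different numbers for different pairs): 1. $+-\ \to\ 11$; 2. $-+\ \to\ 11$; 3. $11+\ \to\ 1{+}1$; 4. $11-\ \to\ 1{-}1$; 5. $+11\ \to\ 1{+}1$; 6. $-11\ \to\ 1{-}1$; 7. $1122\ \to\ 1212$; 8. $1122\ \to\ 1{+}{-}1$; 9. $1122\ \to\ 1{-}{+}1$; 10. $1212\ \to\ 1221$. -/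

import Mathlib

/-- A clan of signature `(p, q)`: an involution `mate` of the `p + q` positions, each fixed point of
which carries a sign `+` or `-` (`sign i = 1` or `sign i = -1`; the value `0` marks exactly the
positions that are not fixed, i.e. those carrying a natural number), such that the number of `+`
signs minus the number of `-` signs is `p - q`.  The two positions `i` and `mate i ≠ i` carry
matching natural numbers. -/
@[ext]
structure Clan (p q : ℕ) where
  mate : Equiv.Perm (Fin (p + q))
  mate_mate : ∀ i, mate (mate i) = i
  sign : Fin (p + q) → SignType
  sign_ne_zero_iff : ∀ i, sign i ≠ 0 ↔ mate i = i
  signature : ((Finset.univ.filter fun i => sign i = 1).card : ℤ)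
    - ((Finset.univ.filter fun i => sign i = -1).card : ℤ) = (p : ℤ) - (q : ℤ)

namespace Clan

variable {p q : ℕ}

/-- The number of pairs of equal natural numbers occurring among `c_1 ... c_i`; a pair is counted
through its first occurrence `s`. -/
def pairsUpTo (γ : Clan p q) (i : Fin (p + q)) : ℕ :=
  (Finset.univ.filter fun s => s < γ.mate s ∧ γ.mate s ≤ i).card

/-- `γ(i; +)`: the number of plus signs and pairs of equal natural numbers among `c_1 ... c_i`. -/
def rankPlus (γ : Clan p q) (i : Fin (p + q)) : ℕ :=
  (Finset.univ.filter fun s => s ≤ i ∧ γ.sign s = 1).card + γ.pairsUpTo i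

/-- `γ(i; -)`: the number of minus signs and pairs of equal natural numbers among `c_1 ... c_i`. -/
def rankMinus (γ : Clan p q) (i : Fin (p + q)) : ℕ :=
  (Finset.univ.filter fun s => s ≤ i ∧ γ.sign s = -1).card + γ.pairsUpTo i

/-- `γ(i; j)`, used for `i < j`: the number of pairs of equal natural numbers `c_s = c_t` with
`s ≤ i < j < t`. -/
def rankPair (γ : Clan p q) (i j : Fin (p + q)) : ℕ :=
  (Finset.univ.filter fun s => s ≤ i ∧ j < γ.mate s).card

/-- The combinatorial Bruhat order on `(p, q)`-clans. -/
instance : LE (Clan p q) where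
  le γ τ := (∀ i, τ.rankPlus i ≤ γ.rankPlus i) ∧ (∀ i, τ.rankMinus i ≤ γ.rankMinus i) ∧
    ∀ i j, i < j → γ.rankPair i j ≤ τ.rankPair i j

/-- The strict relation: `γ ≤ τ` and `γ ≠ τ`. -/
instance : LT (Clan p q) where
  lt γ τ := γ ≤ τ ∧ γ ≠ τ

/-- `γ` and `γ'` carry the same symbols (with the same mates) at all positions outside `S`. -/
def AgreeOff (S : Set (Fin (p + q))) (γ γ' : Clan p q) : Prop :=
  ∀ x, x ∉ S → γ'.mate x = γ.mate x ∧ γ'.sign x = γ.sign x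

/-- `Move γ γ'`: the clan `γ'` is obtained from `γ` by replacing a pattern, found at positions
`i < j (< k (< l))`, by another one at the same positions, where everything else is unchanged.
The equation `mate a = b` with `a < b` says that positions `a` and `b` carry a pair of matching
natural numbers. -/
inductive Move (γ γ' : Clan p q) : Prop
  /-- `+-` becomes `11` -/
  | plus_minus (i j : Fin (p + q)) (hij : i < j)
      (before : γ.sign i = 1 ∧ γ.sign j = -1)
      (after : γ'.mate i = j)
      (off : AgreeOff {i, j} γ γ')
  /-- `-+` becomes `11` -/
  | minus_plus (i j : Fin (p + q)) (hij : i < j)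
      (before : γ.sign i = -1 ∧ γ.sign j = 1)
      (after : γ'.mate i = j)
      (off : AgreeOff {i, j} γ γ')
  /-- `11+` becomes `1+1` -/
  | pair_plus (i j k : Fin (p + q)) (hij : i < j) (hjk : j < k)
      (before : γ.mate i = j ∧ γ.sign k = 1)
      (after : γ'.mate i = k ∧ γ'.sign j = 1)
      (off : AgreeOff {i, j, k} γ γ')
  /-- `11-` becomes `1-1` -/
  | pair_minus (i j k : Fin (p + q)) (hij : i < j) (hjk : j < k)
      (before : γ.mate i = j ∧ γ.sign k = -1)
      (after : γ'.mate i = k ∧ γ'.sign j = -1)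
      (off : AgreeOff {i, j, k} γ γ')
  /-- `+11` becomes `1+1` -/
  | plus_pair (i j k : Fin (p + q)) (hij : i < j) (hjk : j < k)
      (before : γ.sign i = 1 ∧ γ.mate j = k)
      (after : γ'.mate i = k ∧ γ'.sign j = 1)
      (off : AgreeOff {i, j, k} γ γ')
  /-- `-11` becomes `1-1` -/
  | minus_pair (i j k : Fin (p + q)) (hij : i < j) (hjk : j < k)
      (before : γ.sign i = -1 ∧ γ.mate j = k)
      (after : γ'.mate i = k ∧ γ'.sign j = -1)
      (off : AgreeOff {i, j, k} γ γ')
  /-- `1122` becomes `1212` -/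
  | cross (i j k l : Fin (p + q)) (hij : i < j) (hjk : j < k) (hkl : k < l)
      (before : γ.mate i = j ∧ γ.mate k = l)
      (after : γ'.mate i = k ∧ γ'.mate j = l)
      (off : AgreeOff {i, j, k, l} γ γ')
  /-- `1122` becomes `1+-1` -/
  | join_plus_minus (i j k l : Fin (p + q)) (hij : i < j) (hjk : j < k) (hkl : k < l)
      (before : γ.mate i = j ∧ γ.mate k = l)
      (after : γ'.mate i = l ∧ γ'.sign j = 1 ∧ γ'.sign k = -1)
      (off : AgreeOff {i, j, k, l} γ γ')
  /-- `1122` becomes `1-+1` -/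
  | join_minus_plus (i j k l : Fin (p + q)) (hij : i < j) (hjk : j < k) (hkl : k < l)
      (before : γ.mate i = j ∧ γ.mate k = l)
      (after : γ'.mate i = l ∧ γ'.sign j = -1 ∧ γ'.sign k = 1)
      (off : AgreeOff {i, j, k, l} γ γ')
  /-- `1212` becomes `1221` -/
  | nest (i j k l : Fin (p + q)) (hij : i < j) (hjk : j < k) (hkl : k < l)
      (before : γ.mate i = k ∧ γ.mate j = l)
      (after : γ'.mate i = l ∧ γ'.mate j = k)
      (off : AgreeOff {i, j, k, l} γ γ')

end Clan

/-!
Call *gaps* the differences of the two sides of the inequalities that define `γ ≤ τ`. A move changes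
them by `0`, `1` or `2` on explicit intervals and boxes of positions, so one has to find a pattern
in `γ` on whose box the gaps are large enough.

Let `f` be the first position where `γ` and `τ` differ. There `τ` has a pair `(f, m)`, and `γ` has a
sign (put `a = f`) or a pair `(f, a)`, with `a < m`. If pairs of `γ` cross `(f, a)` from inside and
end by `m`, the one among them that starts first yields `1212 → 1221`. Otherwise the gaps of
`γ(x; y)` are positive for `f ≤ x ≤ y < m`, `a ≤ y`, as long as `x` stays before the first pair of
`γ` inside `(a, m]`. So the symbol at `f` can be combined with the first sign `δ` or pair of `γ`
inside `(a, m]`, provided that the gaps of `γ(x; -δ)` are positive in between.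

Moving through `(a, m]`, the gap of `γ(x; δ)` grows only at a sign `δ` or a pair inside, and it
drops at `m`, where the pair of `τ` ends. If it vanishes somewhere, there must therefore be such a
symbol further on, and until then it stays zero; the gap of `γ(x; -δ)` is positive there, because
the two add up to the gap of `γ(x; x)`. Hence one of the two choices of `δ` works if `γ` has any
sign or pair inside `(a, m]`. If it has none, the gaps are large throughout, and `1122 → 1212`
applies to `(f, a)` and that pair from `(a, m]` to beyond `m` which ends first.
-/

section CountUpTo

variable {α : Type*} [Fintype α] [LinearOrder α] {P Q : α → Prop} [DecidablePred P]
  [DecidablePred Q] {i u v x₀ : α}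

/-- The number of elements `s ≤ i` satisfying `P`; both rank functions of a clan are of this form,
which lets one treat them alike. -/
def countUpTo (P : α → Prop) [DecidablePred P] (i : α) : ℕ :=
  (Finset.univ.filter fun s => s ≤ i ∧ P s).card

theorem countUpTo_le_countUpTo (h : ∀ s ≤ i, P s → Q s) : countUpTo P i ≤ countUpTo Q i :=
  Finset.card_le_card (Finset.monotone_filter_right _ fun s _ hs => ⟨hs.1, h s hs.1 hs.2⟩)

theorem countUpTo_lt_countUpTo (h : ∀ s ≤ i, P s → Q s) (hx₀ : x₀ ≤ i) (hP : ¬P x₀) (hQ : Q x₀) :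
    countUpTo P i < countUpTo Q i := by
  refine Finset.card_lt_card <| Finset.ssubset_iff_subset_ne.2
    ⟨Finset.monotone_filter_right _ fun s _ hs => ⟨hs.1, h s hs.1 hs.2⟩, fun heq => hP ?_⟩
  have hmem : x₀ ∈ Finset.univ.filter fun s => s ≤ i ∧ Q s := by simp [hx₀, hQ]
  exact (Finset.mem_filter.1 (heq ▸ hmem)).2.2

theorem countUpTo_eq_add_of_iff {R : α → Prop} [DecidablePred R] (h : ∀ s ≤ i, R s ↔ P s ∨ Q s)
    (hPQ : ∀ s ≤ i, P s → ¬Q s) : countUpTo R i = countUpTo P i + countUpTo Q i := by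
  unfold countUpTo
  rw [← Finset.card_union_of_disjoint (Finset.disjoint_filter.2 fun s _ hP hQ =>
    hPQ s hP.1 hP.2 hQ.2), ← Finset.filter_or]
  congr 1
  grind

theorem countUpTo_eq_add_of_le (huv : u ≤ v) :
    countUpTo P v = countUpTo P u + countUpTo (fun s => u < s ∧ P s) v := by
  have hu : countUpTo P u = countUpTo (fun s => s ≤ u ∧ P s) v := by
    unfold countUpTo
    congr 1
    grind
  rw [hu]
  exact countUpTo_eq_add_of_iff (by grind) (by grind)

theorem countUpTo_sub_le_of_le (huv : u ≤ v) (h : ∀ s, u < s → s ≤ v → P s → Q s) :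
    (countUpTo P v - countUpTo Q v : ℤ) ≤ countUpTo P u - countUpTo Q u := by
  have := countUpTo_le_countUpTo (P := fun s => u < s ∧ P s) (Q := fun s => u < s ∧ Q s) (i := v)
    fun s hsv hs => ⟨hs.1, h s hs.1 hsv hs.2⟩
  rw [countUpTo_eq_add_of_le (P := P) huv, countUpTo_eq_add_of_le (P := Q) huv]
  lia

theorem countUpTo_sub_lt_of_le (h : ∀ s, u < s → s ≤ v → P s → Q s) (hu : u < x₀) (hv : x₀ ≤ v)
    (hP : ¬P x₀) (hQ : Q x₀) :
    (countUpTo P v - countUpTo Q v : ℤ) < countUpTo P u - countUpTo Q u := by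
  have huv := hu.le.trans hv
  have := countUpTo_lt_countUpTo (P := fun s => u < s ∧ P s) (Q := fun s => u < s ∧ Q s)
    (fun s hsv hs => ⟨hs.1, h s hs.1 hsv hs.2⟩) hv (fun hs => hP hs.2) ⟨hu, hQ⟩
  rw [countUpTo_eq_add_of_le (P := P) huv, countUpTo_eq_add_of_le (P := Q) huv]
  lia

theorem countUpTo_sub_eq_sum {S : Finset α} (h : ∀ s ∉ S, (P s ↔ Q s)) :
    (countUpTo P i - countUpTo Q i : ℤ) =
      ∑ s ∈ S, ((if s ≤ i ∧ P s then 1 else 0) - (if s ≤ i ∧ Q s then 1 else 0)) := by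
  rw [Finset.sum_subset S.subset_univ fun s _ hs => by simp [h s hs], Finset.sum_sub_distrib,
    Finset.sum_boole, Finset.sum_boole]
  rfl

end CountUpTo

section SumOverIncreasingTuple

variable {α M : Type*} [LinearOrder α] [AddCommMonoid M] {i j k l : α}

theorem sum_triple_of_lt (hij : i < j) (hjk : j < k) (F : α → M) :
    ∑ s ∈ {i, j, k}, F s = F i + F j + F k := by
  rw [Finset.sum_insert (by grind), Finset.sum_pair hjk.ne, add_assoc]

theorem sum_quadruple_of_lt (hij : i < j) (hjk : j < k) (hkl : k < l) (F : α → M) :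
    ∑ s ∈ {i, j, k, l}, F s = F i + F j + F k + F l := by
  rw [Finset.sum_insert (by grind), sum_triple_of_lt hjk hkl, add_assoc, add_assoc, add_assoc]

end SumOverIncreasingTuple

theorem sum_coe_signType_eq_card_sub_card {α : Type*} [Fintype α] (σ : α → SignType) :
    ∑ s, (σ s : ℤ) = ((Finset.univ.filter fun i => σ i = 1).card : ℤ)
      - ((Finset.univ.filter fun i => σ i = -1).card : ℤ) := by
  have hcoe : ∀ ε : SignType, (ε : ℤ) = (if ε = 1 then 1 else 0) - if ε = -1 then 1 else 0 := by
    decide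
  simp only [hcoe, Finset.sum_sub_distrib, Finset.sum_boole]

theorem signType_eq_or_eq_neg {δ ε : SignType} (hδ : δ ≠ 0) (hε : ε ≠ 0) : ε = δ ∨ ε = -δ := by
  decide +revert

namespace Clan

variable {p q : ℕ} {γ γ' τ : Clan p q} {δ : SignType} {f i j k l u v x y x₀ : Fin (p + q)}

theorem mate_eq_comm : γ.mate i = j ↔ γ.mate j = i :=
  ⟨fun h => h ▸ γ.mate_mate i, fun h => h ▸ γ.mate_mate j⟩

theorem sign_eq_zero_iff : γ.sign i = 0 ↔ γ.mate i ≠ i := by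
  rw [Ne, ← γ.sign_ne_zero_iff, not_not]

theorem mate_eq_self_of_sign_eq (hδ : δ ≠ 0) (h : γ.sign i = δ) : γ.mate i = i :=
  (γ.sign_ne_zero_iff i).1 (h ▸ hδ)

/-- The condition for `γ(s; δ)`, as a function of the position, to increase at `s`: a pair of
natural numbers is charged to its second occurrence. -/
abbrev RisesAt (γ : Clan p q) (δ : SignType) (s : Fin (p + q)) : Prop :=
  γ.sign s = δ ∨ γ.mate s < s

/-- How far `γ(i; δ) ≥ τ(i; δ)` is from being an equality, for a sign `δ`. -/
def signGap (γ τ : Clan p q) (δ : SignType) (i : Fin (p + q)) : ℤ :=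
  countUpTo (γ.RisesAt δ) i - countUpTo (τ.RisesAt δ) i

/-- How far `γ(i; j) ≤ τ(i; j)` is from being an equality. -/
def pairGap (γ τ : Clan p q) (i j : Fin (p + q)) : ℤ :=
  τ.rankPair i j - γ.rankPair i j

theorem pairsUpTo_eq_countUpTo (γ : Clan p q) (i : Fin (p + q)) :
    γ.pairsUpTo i = countUpTo (fun s => γ.mate s < s) i :=
  Finset.card_equiv γ.mate fun s => by simp [γ.mate_mate, and_comm]

theorem countUpTo_risesAt (γ : Clan p q) (hδ : δ ≠ 0) (i : Fin (p + q)) :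
    countUpTo (γ.RisesAt δ) i = countUpTo (fun s => γ.sign s = δ) i + γ.pairsUpTo i := by
  rw [pairsUpTo_eq_countUpTo]
  exact countUpTo_eq_add_of_iff (fun s _ => Iff.rfl) fun s _ hs hlt =>
    hlt.ne (mate_eq_self_of_sign_eq hδ hs)

theorem signGap_one (γ τ : Clan p q) (i : Fin (p + q)) :
    γ.signGap τ 1 i = γ.rankPlus i - τ.rankPlus i := by
  rw [signGap, countUpTo_risesAt γ (by decide), countUpTo_risesAt τ (by decide)]
  rfl

theorem signGap_neg_one (γ τ : Clan p q) (i : Fin (p + q)) :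
    γ.signGap τ (-1) i = γ.rankMinus i - τ.rankMinus i := by
  rw [signGap, countUpTo_risesAt γ (by decide), countUpTo_risesAt τ (by decide)]
  rfl

theorem countUpTo_risesAt_add_neg_add_rankPair (γ : Clan p q) (hδ : δ ≠ 0) (i : Fin (p + q)) :
    countUpTo (γ.RisesAt δ) i + countUpTo (γ.RisesAt (-δ)) i + γ.rankPair i i =
      countUpTo (fun _ => True) i := by
  have hδ' : -δ ≠ 0 := SignType.neg_eq_zero_iff.not.2 hδ
  have hopen : countUpTo (fun s => s < γ.mate s) i = γ.pairsUpTo i + γ.rankPair i i := by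
    have hclosed : γ.pairsUpTo i = countUpTo (fun s => s < γ.mate s ∧ γ.mate s ≤ i) i := by
      unfold pairsUpTo countUpTo
      congr 1
      grind
    rw [hclosed]
    exact countUpTo_eq_add_of_iff (Q := fun s => i < γ.mate s) (by grind) (by grind)
  have hfixed : countUpTo (fun s => γ.mate s = s) i =
      countUpTo (fun s => γ.sign s = δ) i + countUpTo (fun s => γ.sign s = -δ) i := by
    refine countUpTo_eq_add_of_iff (fun s _ => ?_) fun s _ hs hs' => ?_
    · rw [← γ.sign_ne_zero_iff]
      exact ⟨signType_eq_or_eq_neg hδ, fun h => h.elim (· ▸ hδ) (· ▸ hδ')⟩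
    · exact hδ (SignType.self_eq_neg_iff.1 (hs.symm.trans hs'))
  have hmoved : countUpTo (fun s => γ.mate s ≠ s) i =
      countUpTo (fun s => γ.mate s < s) i + countUpTo (fun s => s < γ.mate s) i :=
    countUpTo_eq_add_of_iff (fun s _ => lt_or_lt_iff_ne.symm) fun s _ => lt_asymm
  have hall : countUpTo (fun _ => True) i =
      countUpTo (fun s => γ.mate s = s) i + countUpTo (fun s => γ.mate s ≠ s) i :=
    countUpTo_eq_add_of_iff (by grind) (by grind)
  rw [countUpTo_risesAt γ hδ, countUpTo_risesAt γ hδ', hall, hfixed, hmoved, hopen,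
    ← pairsUpTo_eq_countUpTo]
  ring

theorem signGap_add_signGap_neg (γ τ : Clan p q) (hδ : δ ≠ 0) (i : Fin (p + q)) :
    γ.signGap τ δ i + γ.signGap τ (-δ) i = γ.pairGap τ i i := by
  have hγ := countUpTo_risesAt_add_neg_add_rankPair γ hδ i
  have hτ := countUpTo_risesAt_add_neg_add_rankPair τ hδ i
  unfold signGap pairGap
  lia

theorem le_iff_gaps_nonneg : γ ≤ τ ↔
    (∀ δ ≠ 0, ∀ i, 0 ≤ γ.signGap τ δ i) ∧ ∀ i j, i ≤ j → 0 ≤ γ.pairGap τ i j := by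
  have hle : γ ≤ τ ↔ (∀ i, 0 ≤ γ.signGap τ 1 i) ∧ (∀ i, 0 ≤ γ.signGap τ (-1) i) ∧
      ∀ i j, i < j → 0 ≤ γ.pairGap τ i j := by
    simp only [signGap_one, signGap_neg_one, pairGap, sub_nonneg, Nat.cast_le]
    rfl
  rw [hle]
  refine ⟨fun ⟨hplus, hminus, hpair⟩ => ⟨fun δ hδ i => ?_, fun i j hij => ?_⟩,
    fun ⟨hsign, hpair⟩ => ⟨hsign 1 (by decide), hsign (-1) (by decide),
      fun i j hij => hpair i j hij.le⟩⟩
  · rcases signType_eq_or_eq_neg (δ := 1) (by decide) hδ with rfl | rfl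
    exacts [hplus i, hminus i]
  · rcases hij.lt_or_eq with hij | rfl
    · exact hpair i j hij
    · rw [← signGap_add_signGap_neg γ τ (δ := 1) (by decide)]
      exact add_nonneg (hplus i) (hminus i)

theorem Move.ne (h : Move γ γ') : γ ≠ γ' := by
  rintro rfl
  have hsign := γ.sign_ne_zero_iff
  have hplus : (1 : SignType) ≠ 0 := by decide
  have hminus : (-1 : SignType) ≠ 0 := by decide
  cases h <;> grind

theorem Move.exists_of_gap_le (hmove : Move γ γ')
    (hsign : ∀ δ ≠ 0, ∀ x, 0 ≤ γ.signGap γ' δ x ∧ γ.signGap γ' δ x ≤ γ.signGap τ δ x)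
    (hpair : ∀ x y, x ≤ y → 0 ≤ γ.pairGap γ' x y ∧ γ.pairGap γ' x y ≤ γ.pairGap τ x y) :
    ∃ γ', γ < γ' ∧ γ' ≤ τ ∧ Move γ γ' := by
  refine ⟨γ', ⟨le_iff_gaps_nonneg.2 ⟨fun δ hδ x => (hsign δ hδ x).1, fun x y hxy =>
    (hpair x y hxy).1⟩, hmove.ne⟩,
    le_iff_gaps_nonneg.2 ⟨fun δ hδ x => ?_, fun x y hxy => ?_⟩, hmove⟩
  · have := (hsign δ hδ x).2
    unfold signGap at *
    lia
  · have := (hpair x y hxy).2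
    unfold pairGap at *
    lia

theorem exists_agreeOff (γ : Clan p q) (S : Finset (Fin (p + q)))
    (m : Fin (p + q) → Fin (p + q)) (σ : Fin (p + q) → SignType)
    (hS : ∀ s ∈ S, γ.mate s ∈ S) (hm : ∀ s ∈ S, m s ∈ S ∧ m (m s) = s)
    (hσ : ∀ s ∈ S, σ s ≠ 0 ↔ m s = s) (hsum : ∑ s ∈ S, (σ s : ℤ) = ∑ s ∈ S, (γ.sign s : ℤ)) :
    ∃ γ' : Clan p q, AgreeOff S γ γ' ∧ ∀ s ∈ S, γ'.mate s = m s ∧ γ'.sign s = σ s := by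
  have hS' : ∀ s ∉ S, γ.mate s ∉ S := fun s hs h => hs (γ.mate_mate s ▸ hS _ h)
  have hinv : Function.Involutive fun s => if s ∈ S then m s else γ.mate s := by
    intro s
    by_cases hs : s ∈ S
    · simp [hs, hm s hs]
    · simp [hs, hS' s hs, γ.mate_mate]
  refine ⟨⟨hinv.toPerm, hinv, fun s => if s ∈ S then σ s else γ.sign s, fun s => ?_, ?_⟩,
    fun s hs => ?_, fun s hs => ?_⟩
  · by_cases hs : s ∈ S
    · simpa [hs] using hσ s hs
    · simpa [hs] using γ.sign_ne_zero_iff s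
  · rw [← γ.signature, ← sum_coe_signType_eq_card_sub_card, ← sum_coe_signType_eq_card_sub_card,
      ← S.sum_add_sum_compl, ← S.sum_add_sum_compl fun s => (γ.sign s : ℤ), ← hsum]
    congr 1
    · exact Finset.sum_congr rfl fun s hs => by simp [hs]
    · exact Finset.sum_congr rfl fun s hs => by simp [Finset.mem_compl.1 hs]
  · simp [Finset.mem_coe.not.1 hs]
  · simp [hs]

theorem signGap_eq_sum_of_agreeOff {S : Finset (Fin (p + q))} (h : AgreeOff S γ γ') :
    γ.signGap γ' δ x = ∑ s ∈ S,
      ((if s ≤ x ∧ γ.RisesAt δ s then 1 else 0) - if s ≤ x ∧ γ'.RisesAt δ s then 1 else 0) :=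
  countUpTo_sub_eq_sum fun s hs => by
    rw [RisesAt, RisesAt, (h s (Finset.mem_coe.not.2 hs)).1, (h s (Finset.mem_coe.not.2 hs)).2]

theorem pairGap_eq_sum_of_agreeOff {S : Finset (Fin (p + q))} (h : AgreeOff S γ γ') :
    γ.pairGap γ' x y = ∑ s ∈ S,
      ((if s ≤ x ∧ y < γ'.mate s then 1 else 0) - if s ≤ x ∧ y < γ.mate s then 1 else 0) :=
  countUpTo_sub_eq_sum fun s hs => by rw [(h s (Finset.mem_coe.not.2 hs)).1]

theorem exists_move_sign_neg (hδ : δ ≠ 0) (hij : i < j) (hsi : γ.sign i = -δ)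
    (hsj : γ.sign j = δ) :
    ∃ γ', Move γ γ' ∧
      (∀ δ' ≠ 0, ∀ x, γ.signGap γ' δ' x = if δ' = -δ ∧ i ≤ x ∧ x < j then 1 else 0) ∧
      ∀ x y, x ≤ y → γ.pairGap γ' x y = if i ≤ x ∧ y < j then 1 else 0 := by
  have hi := mate_eq_self_of_sign_eq (SignType.neg_eq_zero_iff.not.2 hδ) hsi
  have hj := mate_eq_self_of_sign_eq hδ hsj
  have hne := SignType.self_eq_neg_iff.not.2 hδ
  obtain ⟨γ', hoff, hnew⟩ := γ.exists_agreeOff {i, j} (fun s => if s = i then j else i)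
    (fun _ => 0) (by grind) (by grind) (by grind)
    (by rw [Finset.sum_pair hij.ne, Finset.sum_pair hij.ne, hsi, hsj]; simp)
  obtain ⟨hi', hsi'⟩ : γ'.mate i = j ∧ γ'.sign i = 0 := by grind
  obtain ⟨hj', hsj'⟩ : γ'.mate j = i ∧ γ'.sign j = 0 := by grind
  refine ⟨γ', ?_, fun δ' hδ' x => ?_, fun x y hxy => ?_⟩
  · rw [Finset.coe_pair] at hoff
    rcases signType_eq_or_eq_neg (δ := 1) (by decide) hδ with rfl | rfl
    · exact .minus_plus i j hij ⟨hsi, hsj⟩ hi' hoff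
    · exact .plus_minus i j hij ⟨hsi, hsj⟩ hi' hoff
  · rw [signGap_eq_sum_of_agreeOff hoff, Finset.sum_pair hij.ne]
    rcases signType_eq_or_eq_neg hδ hδ' with rfl | rfl <;> grind
  · rw [pairGap_eq_sum_of_agreeOff hoff, Finset.sum_pair hij.ne]
    grind

theorem exists_move_sign_pair (hδ : δ ≠ 0) (hij : i < j) (hjk : j < k) (hsi : γ.sign i = -δ)
    (hj : γ.mate j = k) :
    ∃ γ', Move γ γ' ∧
      (∀ δ' ≠ 0, ∀ x, γ.signGap γ' δ' x = if δ' = -δ ∧ i ≤ x ∧ x < j then 1 else 0) ∧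
      ∀ x y, x ≤ y → γ.pairGap γ' x y = if i ≤ x ∧ x < j ∧ y < k then 1 else 0 := by
  have hδ' : -δ ≠ 0 := SignType.neg_eq_zero_iff.not.2 hδ
  have hi := mate_eq_self_of_sign_eq hδ' hsi
  have hk := mate_eq_comm.1 hj
  have hsj : γ.sign j = 0 := sign_eq_zero_iff.2 (by grind)
  have hsk : γ.sign k = 0 := sign_eq_zero_iff.2 (by grind)
  have hne := SignType.self_eq_neg_iff.not.2 hδ
  obtain ⟨γ', hoff, hnew⟩ := γ.exists_agreeOff {i, j, k}
    (fun s => if s = i then k else if s = k then i else j) (fun s => if s = j then -δ else 0)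
    (by grind) (by grind) (by grind)
    (by rw [sum_triple_of_lt hij hjk, sum_triple_of_lt hij hjk, hsi, hsj, hsk]
        simp [hij.ne, hjk.ne'])
  obtain ⟨hi', hsi'⟩ : γ'.mate i = k ∧ γ'.sign i = 0 := by grind
  obtain ⟨hj', hsj'⟩ : γ'.mate j = j ∧ γ'.sign j = -δ := by grind
  have hk' : γ'.mate k = i := by grind
  refine ⟨γ', ?_, fun δ' hδ' x => ?_, fun x y hxy => ?_⟩
  · replace hoff : AgreeOff {i, j, k} γ γ' := by simpa using hoff
    rcases signType_eq_or_eq_neg (δ := 1) (by decide) hδ with rfl | rfl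
    · exact .minus_pair i j k hij hjk ⟨hsi, hj⟩ ⟨hi', hsj'⟩ hoff
    · exact .plus_pair i j k hij hjk ⟨hsi, hj⟩ ⟨hi', hsj'⟩ hoff
  · rw [signGap_eq_sum_of_agreeOff hoff, sum_triple_of_lt hij hjk]
    rcases signType_eq_or_eq_neg hδ hδ' with rfl | rfl <;> grind
  · rw [pairGap_eq_sum_of_agreeOff hoff, sum_triple_of_lt hij hjk]
    grind

theorem exists_move_pair_sign (hδ : δ ≠ 0) (hij : i < j) (hjk : j < k) (hi : γ.mate i = j)
    (hsk : γ.sign k = δ) :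
    ∃ γ', Move γ γ' ∧
      (∀ δ' ≠ 0, ∀ x, γ.signGap γ' δ' x = if δ' = -δ ∧ j ≤ x ∧ x < k then 1 else 0) ∧
      ∀ x y, x ≤ y → γ.pairGap γ' x y = if i ≤ x ∧ j ≤ y ∧ y < k then 1 else 0 := by
  have hk := mate_eq_self_of_sign_eq hδ hsk
  have hj := mate_eq_comm.1 hi
  have hsi : γ.sign i = 0 := sign_eq_zero_iff.2 (by grind)
  have hsj : γ.sign j = 0 := sign_eq_zero_iff.2 (by grind)
  have hne := SignType.self_eq_neg_iff.not.2 hδ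
  obtain ⟨γ', hoff, hnew⟩ := γ.exists_agreeOff {i, j, k}
    (fun s => if s = i then k else if s = k then i else j) (fun s => if s = j then δ else 0)
    (by grind) (by grind) (by grind)
    (by rw [sum_triple_of_lt hij hjk, sum_triple_of_lt hij hjk, hsi, hsj, hsk]
        simp [hij.ne, hjk.ne'])
  obtain ⟨hi', hsi'⟩ : γ'.mate i = k ∧ γ'.sign i = 0 := by grind
  obtain ⟨hj', hsj'⟩ : γ'.mate j = j ∧ γ'.sign j = δ := by grind
  have hk' : γ'.mate k = i := by grind
  refine ⟨γ', ?_, fun δ' hδ' x => ?_, fun x y hxy => ?_⟩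
  · replace hoff : AgreeOff {i, j, k} γ γ' := by simpa using hoff
    rcases signType_eq_or_eq_neg (δ := 1) (by decide) hδ with rfl | rfl
    · exact .pair_plus i j k hij hjk ⟨hi, hsk⟩ ⟨hi', hsj'⟩ hoff
    · exact .pair_minus i j k hij hjk ⟨hi, hsk⟩ ⟨hi', hsj'⟩ hoff
  · rw [signGap_eq_sum_of_agreeOff hoff, sum_triple_of_lt hij hjk]
    rcases signType_eq_or_eq_neg hδ hδ' with rfl | rfl <;> grind
  · rw [pairGap_eq_sum_of_agreeOff hoff, sum_triple_of_lt hij hjk]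
    grind

theorem exists_move_join (hδ : δ ≠ 0) (hij : i < j) (hjk : j < k) (hkl : k < l)
    (hi : γ.mate i = j) (hk : γ.mate k = l) :
    ∃ γ', Move γ γ' ∧
      (∀ δ' ≠ 0, ∀ x, γ.signGap γ' δ' x = if δ' = -δ ∧ j ≤ x ∧ x < k then 1 else 0) ∧
      ∀ x y, x ≤ y → γ.pairGap γ' x y = if i ≤ x ∧ x < k ∧ j ≤ y ∧ y < l then 1 else 0 := by
  have hj := mate_eq_comm.1 hi
  have hl := mate_eq_comm.1 hk
  have hsi : γ.sign i = 0 := sign_eq_zero_iff.2 (by grind)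
  have hsj : γ.sign j = 0 := sign_eq_zero_iff.2 (by grind)
  have hsk : γ.sign k = 0 := sign_eq_zero_iff.2 (by grind)
  have hsl : γ.sign l = 0 := sign_eq_zero_iff.2 (by grind)
  have hne := SignType.self_eq_neg_iff.not.2 hδ
  have hδ' : -δ ≠ 0 := SignType.neg_eq_zero_iff.not.2 hδ
  obtain ⟨γ', hoff, hnew⟩ := γ.exists_agreeOff {i, j, k, l}
    (fun s => if s = i then l else if s = l then i else s)
    (fun s => if s = j then δ else if s = k then -δ else 0)
    (by grind) (by grind) (by grind)
    (by rw [sum_quadruple_of_lt hij hjk hkl, sum_quadruple_of_lt hij hjk hkl, hsi, hsj, hsk, hsl]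
        simp [hij.ne, (hij.trans hjk).ne, hjk.ne', hkl.ne', (hjk.trans hkl).ne'])
  obtain ⟨hi', hsi'⟩ : γ'.mate i = l ∧ γ'.sign i = 0 := by grind
  obtain ⟨hj', hsj'⟩ : γ'.mate j = j ∧ γ'.sign j = δ := by grind
  obtain ⟨hk', hsk'⟩ : γ'.mate k = k ∧ γ'.sign k = -δ := by grind
  have hl' : γ'.mate l = i := by grind
  refine ⟨γ', ?_, fun δ' hδ' x => ?_, fun x y hxy => ?_⟩
  · replace hoff : AgreeOff {i, j, k, l} γ γ' := by simpa using hoff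
    rcases signType_eq_or_eq_neg (δ := 1) (by decide) hδ with rfl | rfl
    · exact .join_plus_minus i j k l hij hjk hkl ⟨hi, hk⟩ ⟨hi', hsj', hsk'⟩ hoff
    · exact .join_minus_plus i j k l hij hjk hkl ⟨hi, hk⟩ ⟨hi', hsj', hsk'⟩ hoff
  · rw [signGap_eq_sum_of_agreeOff hoff, sum_quadruple_of_lt hij hjk hkl]
    rcases signType_eq_or_eq_neg hδ hδ' with rfl | rfl <;> grind
  · rw [pairGap_eq_sum_of_agreeOff hoff, sum_quadruple_of_lt hij hjk hkl]
    grind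

theorem exists_move_cross (hij : i < j) (hjk : j < k) (hkl : k < l) (hi : γ.mate i = j)
    (hk : γ.mate k = l) :
    ∃ γ', Move γ γ' ∧
      (∀ δ' ≠ 0, ∀ x, γ.signGap γ' δ' x = if j ≤ x ∧ x < k then 1 else 0) ∧
      ∀ x y, x ≤ y → γ.pairGap γ' x y = (if i ≤ x ∧ j ≤ y ∧ y < k then 1 else 0) +
        if j ≤ x ∧ x < k ∧ y < l then 1 else 0 := by
  have hj := mate_eq_comm.1 hi
  have hl := mate_eq_comm.1 hk
  have hsi : γ.sign i = 0 := sign_eq_zero_iff.2 (by grind)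
  have hsj : γ.sign j = 0 := sign_eq_zero_iff.2 (by grind)
  have hsk : γ.sign k = 0 := sign_eq_zero_iff.2 (by grind)
  have hsl : γ.sign l = 0 := sign_eq_zero_iff.2 (by grind)
  obtain ⟨γ', hoff, hnew⟩ := γ.exists_agreeOff {i, j, k, l}
    (fun s => if s = i then k else if s = j then l else if s = k then i else j) (fun _ => 0)
    (by grind) (by grind) (by grind)
    (by rw [sum_quadruple_of_lt hij hjk hkl, sum_quadruple_of_lt hij hjk hkl, hsi, hsj, hsk, hsl])
  obtain ⟨hi', hsi'⟩ : γ'.mate i = k ∧ γ'.sign i = 0 := by grind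
  obtain ⟨hj', hsj'⟩ : γ'.mate j = l ∧ γ'.sign j = 0 := by grind
  have hk' : γ'.mate k = i := by grind
  have hl' : γ'.mate l = j := by grind
  refine ⟨γ', ?_, fun δ' hδ' x => ?_, fun x y hxy => ?_⟩
  · exact .cross i j k l hij hjk hkl ⟨hi, hk⟩ ⟨hi', hj'⟩ (by simpa using hoff)
  · rw [signGap_eq_sum_of_agreeOff hoff, sum_quadruple_of_lt hij hjk hkl]
    grind
  · rw [pairGap_eq_sum_of_agreeOff hoff, sum_quadruple_of_lt hij hjk hkl]
    grind

theorem exists_move_nest (hij : i < j) (hjk : j < k) (hkl : k < l) (hi : γ.mate i = k)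
    (hj : γ.mate j = l) :
    ∃ γ', Move γ γ' ∧ (∀ δ' ≠ 0, ∀ x, γ.signGap γ' δ' x = 0) ∧
      ∀ x y, x ≤ y → γ.pairGap γ' x y = if i ≤ x ∧ x < j ∧ k ≤ y ∧ y < l then 1 else 0 := by
  have hk := mate_eq_comm.1 hi
  have hl := mate_eq_comm.1 hj
  have hsi : γ.sign i = 0 := sign_eq_zero_iff.2 (by grind)
  have hsj : γ.sign j = 0 := sign_eq_zero_iff.2 (by grind)
  have hsk : γ.sign k = 0 := sign_eq_zero_iff.2 (by grind)
  have hsl : γ.sign l = 0 := sign_eq_zero_iff.2 (by grind)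
  obtain ⟨γ', hoff, hnew⟩ := γ.exists_agreeOff {i, j, k, l}
    (fun s => if s = i then l else if s = j then k else if s = k then j else i) (fun _ => 0)
    (by grind) (by grind) (by grind)
    (by rw [sum_quadruple_of_lt hij hjk hkl, sum_quadruple_of_lt hij hjk hkl, hsi, hsj, hsk, hsl])
  obtain ⟨hi', hsi'⟩ : γ'.mate i = l ∧ γ'.sign i = 0 := by grind
  obtain ⟨hj', hsj'⟩ : γ'.mate j = k ∧ γ'.sign j = 0 := by grind
  have hk' : γ'.mate k = j := by grind
  have hl' : γ'.mate l = i := by grind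
  refine ⟨γ', ?_, fun δ' hδ' x => ?_, fun x y hxy => ?_⟩
  · exact .nest i j k l hij hjk hkl ⟨hi, hj⟩ ⟨hi', hj'⟩ (by simpa using hoff)
  · rw [signGap_eq_sum_of_agreeOff hoff, sum_quadruple_of_lt hij hjk hkl]
    grind
  · rw [pairGap_eq_sum_of_agreeOff hoff, sum_quadruple_of_lt hij hjk hkl]
    grind

/-- `f` is the first position at which `γ ≤ τ` differ. There `τ` has the first of two matching
numbers, while `γ` has a sign or a number whose second occurrence comes earlier than in `τ`. -/
structure FirstDifference (γ τ : Clan p q) (f : Fin (p + q)) : Prop where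
  le : γ ≤ τ
  agree : ∀ s < f, γ.mate s = τ.mate s ∧ γ.sign s = τ.sign s
  le_mate : f ≤ γ.mate f
  mate_lt_mate : γ.mate f < τ.mate f

theorem agree_of_mate_lt (agree : ∀ s < f, γ.mate s = τ.mate s ∧ γ.sign s = τ.sign s)
    (hf : γ.mate f < f) : γ.mate f = τ.mate f ∧ γ.sign f = τ.sign f := by
  have hmate : τ.mate f = γ.mate f := mate_eq_comm.1 ((agree _ hf).1.symm.trans (γ.mate_mate f))
  rw [sign_eq_zero_iff.2 hf.ne, sign_eq_zero_iff.2 (hmate ▸ hf.ne)]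
  exact ⟨hmate.symm, rfl⟩

theorem exists_firstDifference (h : γ < τ) : ∃ f, FirstDifference γ τ f := by
  obtain ⟨hle, hne⟩ := h
  have hex : ∃ f, ¬(γ.mate f = τ.mate f ∧ γ.sign f = τ.sign f) := by
    by_contra! hall
    exact hne (Clan.ext (Equiv.ext fun s => (hall s).1) (funext fun s => (hall s).2))
  obtain ⟨f, hf⟩ := exists_minimal_of_wellFoundedLT _ hex
  have agree : ∀ s < f, γ.mate s = τ.mate s ∧ γ.sign s = τ.sign s := fun s hs =>
    not_not.1 (hf.not_prop_of_lt hs)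
  have hγf : f ≤ γ.mate f := not_lt.1 fun hlt => hf.prop (agree_of_mate_lt agree hlt)
  have hτf : f ≤ τ.mate f := not_lt.1 fun hlt => hf.prop <| (agree_of_mate_lt
    (fun s hs => (agree s hs).imp Eq.symm Eq.symm) hlt).imp Eq.symm Eq.symm
  obtain ⟨hsign, hpair⟩ := le_iff_gaps_nonneg.1 hle
  refine ⟨f, hle, agree, hγf, lt_of_not_ge fun hge => hf.prop ?_⟩
  rcases hτf.eq_or_lt with hfix | hlt
  · have hδ : τ.sign f ≠ 0 := (τ.sign_ne_zero_iff f).2 hfix.symm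
    by_contra hdiff
    have hcount := countUpTo_lt_countUpTo (P := γ.RisesAt (τ.sign f))
      (Q := τ.RisesAt (τ.sign f)) (by grind) le_rfl
      (fun hrise => hrise.elim
        (fun hs => hdiff ⟨(mate_eq_self_of_sign_eq hδ hs).trans hfix, hs⟩) hγf.not_gt) (.inl rfl)
    have := hsign _ hδ f
    unfold signGap at this
    lia
  · rcases hge.eq_or_lt with heq | hgt
    · rw [sign_eq_zero_iff.2 hlt.ne', sign_eq_zero_iff.2 (heq ▸ hlt.ne')]
      exact ⟨heq.symm, rfl⟩
    · have hcount : τ.rankPair f (τ.mate f) < γ.rankPair f (τ.mate f) :=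
        countUpTo_lt_countUpTo (by grind) le_rfl (lt_irrefl _) hgt
      have := hpair f (τ.mate f) hτf
      unfold pairGap at this
      lia

/-- Position `s` carries the first of two matching numbers, the second of which occurs by `m`. -/
def OpensWithin (γ : Clan p q) (m s : Fin (p + q)) : Prop :=
  s < γ.mate s ∧ γ.mate s ≤ m

/-- Position `s` carries a symbol which a move can combine with a symbol further left so as to
decrease `γ(x; -δ)` between the two: the sign `δ`, or a pair that ends by `m`. -/
def IsPartner (γ : Clan p q) (δ : SignType) (m s : Fin (p + q)) : Prop :=
  γ.sign s = δ ∨ γ.OpensWithin m s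

/-- Position `s` is not a partner for either sign. -/
def IsInert (γ : Clan p q) (m s : Fin (p + q)) : Prop :=
  γ.sign s = 0 ∧ ¬γ.OpensWithin m s

theorem IsInert.not_isPartner {m s : Fin (p + q)} (h : γ.IsInert m s) (hδ : δ ≠ 0) :
    ¬γ.IsPartner δ m s :=
  not_or.2 ⟨fun hs => hδ (hs.symm.trans h.1), h.2⟩

theorem exists_isPartner_of_not_isInert {m s : Fin (p + q)} (h : ¬γ.IsInert m s) :
    ∃ δ ≠ 0, γ.IsPartner δ m s := by
  by_cases hs : γ.sign s = 0
  · exact ⟨1, by decide, .inr (by_contra fun hopen => h ⟨hs, hopen⟩)⟩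
  · exact ⟨_, hs, .inl rfl⟩

/-- A pair of `γ` crossing the pair of `γ` at `f` from inside reaches beyond the pair of `τ` at `f`,
so that no `1212` pattern starting at `f` may be turned into `1221`. The condition is void if `γ`
has a sign at `f`. -/
def Unnested (γ τ : Clan p q) (f : Fin (p + q)) : Prop :=
  ∀ s, f < s → s < γ.mate f → γ.mate f < γ.mate s → τ.mate f < γ.mate s

namespace FirstDifference

theorem mate_eq_of_mate_lt (h : FirstDifference γ τ f) (hx : γ.mate x < f) :
    τ.mate x = γ.mate x :=
  mate_eq_comm.1 ((h.agree _ hx).1.symm.trans (γ.mate_mate x))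

theorem one_le_pairGap (h : FirstDifference γ τ f) (hfx : f ≤ x) (hxy : x ≤ y)
    (hfy : γ.mate f ≤ y) (hym : y < τ.mate f)
    (hno : ∀ s, f < s → s ≤ x → y < γ.mate s → τ.mate f < γ.mate s) : 1 ≤ γ.pairGap τ x y := by
  have hsplit : ∀ κ : Clan p q, κ.rankPair x y = κ.rankPair x (τ.mate f) +
      countUpTo (fun s => y < κ.mate s ∧ κ.mate s ≤ τ.mate f) x := fun κ =>
    countUpTo_eq_add_of_iff (P := fun s => τ.mate f < κ.mate s) (by grind) (by grind)
  have hcount : countUpTo (fun s => y < γ.mate s ∧ γ.mate s ≤ τ.mate f) x <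
      countUpTo (fun s => y < τ.mate s ∧ τ.mate s ≤ τ.mate f) x := by
    refine countUpTo_lt_countUpTo (fun s hsx hs => ?_) hfx (fun hf => hfy.not_gt hf.1)
      ⟨hym, le_rfl⟩
    rcases lt_trichotomy s f with hsf | rfl | hfs
    · rwa [← (h.agree s hsf).1]
    · exact absurd hs.1 hfy.not_gt
    · exact absurd (hno s hfs hsx hs.1) hs.2.not_gt
  have hnonneg := (le_iff_gaps_nonneg.1 h.le).2 x (τ.mate f) (hxy.trans hym.le)
  unfold pairGap at *
  rw [hsplit γ, hsplit τ]
  lia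

theorem one_le_pairGap_of_unnested (h : FirstDifference γ τ f) (hun : Unnested γ τ f)
    (hfx : f ≤ x) (hxy : x ≤ y) (hfy : γ.mate f ≤ y) (hym : y < τ.mate f)
    (hno : ∀ s, γ.mate f < s → s ≤ x → ¬γ.OpensWithin (τ.mate f) s) : 1 ≤ γ.pairGap τ x y := by
  refine h.one_le_pairGap hfx hxy hfy hym fun s hfs hsx hys => ?_
  rcases lt_trichotomy s (γ.mate f) with hlt | rfl | hgt
  · exact hun s hfs hlt (hfy.trans_lt hys)
  · rw [γ.mate_mate] at hys
    exact absurd hys (h.le_mate.trans hfy).not_gt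
  · exact not_le.1 fun hsm => hno s hgt hsx ⟨(hsx.trans hxy).trans_lt hys, hsm⟩

theorem mate_lt_of_mate_lt_self (h : FirstDifference γ τ f) (hun : Unnested γ τ f)
    (hfx : γ.mate f < x) (hxm : x ≤ τ.mate f) (hx : γ.mate x < x)
    (hno : ∀ s, γ.mate f < s → s < x → ¬γ.OpensWithin (τ.mate f) s) : γ.mate x < f := by
  have hmm := γ.mate_mate x
  by_contra! hle
  rcases lt_trichotomy (γ.mate x) (γ.mate f) with hlt | heq | hgt
  · rcases hle.eq_or_lt with heq | hfx'
    · exact hfx.ne (heq ▸ hmm)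
    · exact (hmm ▸ hun _ hfx' hlt (hmm.symm ▸ hfx)).not_ge hxm
  · exact (h.le_mate.trans_lt hfx).ne' (γ.mate.injective heq)
  · exact hno _ hgt hx ⟨hmm.symm ▸ hx, hmm.symm ▸ hxm⟩

theorem mate_lt_of_risesAt (h : FirstDifference γ τ f) (hun : Unnested γ τ f)
    (hfx : γ.mate f < x) (hxm : x ≤ τ.mate f)
    (hno : ∀ s, γ.mate f < s → s ≤ x → ¬γ.IsPartner δ (τ.mate f) s) (hx : γ.RisesAt δ x) :
    γ.mate x < f :=
  hx.elim (fun hs => absurd (.inl hs) (hno x hfx le_rfl)) fun hlt =>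
    h.mate_lt_of_mate_lt_self hun hfx hxm hlt fun s hfs hsx hs => hno s hfs hsx.le (.inr hs)

theorem risesAt_of_mate_lt (h : FirstDifference γ τ f) (hfx : f ≤ x) (hx : γ.mate x < f) :
    τ.RisesAt δ x :=
  .inr (h.mate_eq_of_mate_lt hx ▸ hx.trans_le hfx)

theorem signGap_le_of_le (h : FirstDifference γ τ f) (hun : Unnested γ τ f)
    (hfu : γ.mate f ≤ u) (huv : u ≤ v) (hvm : v ≤ τ.mate f)
    (hno : ∀ s, γ.mate f < s → s ≤ v → ¬γ.IsPartner δ (τ.mate f) s) :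
    γ.signGap τ δ v ≤ γ.signGap τ δ u :=
  countUpTo_sub_le_of_le huv fun _ hus hsv hs =>
    h.risesAt_of_mate_lt (h.le_mate.trans (hfu.trans hus.le)) <| h.mate_lt_of_risesAt hun
      (hfu.trans_lt hus) (hsv.trans hvm) (fun t hft hts => hno t hft (hts.trans hsv)) hs

theorem one_le_signGap (h : FirstDifference γ τ f) (hun : Unnested γ τ f) (hδ : δ ≠ 0)
    (hfu : γ.mate f ≤ u) (hum : u < τ.mate f)
    (hno : ∀ s, γ.mate f < s → s ≤ τ.mate f → ¬γ.IsPartner δ (τ.mate f) s) :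
    1 ≤ γ.signGap τ δ u := by
  have hearly : ∀ s, u < s → s ≤ τ.mate f → γ.RisesAt δ s → γ.mate s < f := fun s hus hsm =>
    h.mate_lt_of_risesAt hun (hfu.trans_lt hus) hsm fun t hft hts => hno t hft (hts.trans hsm)
  have hτm := τ.mate_mate f
  have hlt : γ.signGap τ δ (τ.mate f) < γ.signGap τ δ u :=
    countUpTo_sub_lt_of_le (fun s hus hsm hs => h.risesAt_of_mate_lt
      (h.le_mate.trans (hfu.trans hus.le)) (hearly s hus hsm hs)) hum le_rfl
      (fun hs => by
        have hm := hearly _ hum le_rfl hs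
        exact hm.ne ((h.mate_eq_of_mate_lt hm).symm.trans hτm))
      (.inr (hτm.symm ▸ h.le_mate.trans_lt (hfu.trans_lt hum)))
  have hnonneg := (le_iff_gaps_nonneg.1 h.le).1 δ hδ (τ.mate f)
  lia

end FirstDifference

/-- The symbol of `γ` at `j` can be combined with the one at `f` while staying below `τ`: it is a
partner for `δ`, no pair lies between the two, and the ranks `γ(x; -δ)`, which the move decreases,
have room for that. -/
structure IsPivot (γ τ : Clan p q) (f : Fin (p + q)) (δ : SignType) (j : Fin (p + q)) : Prop where
  mate_lt : γ.mate f < j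
  le_mate : j ≤ τ.mate f
  isPartner : γ.IsPartner δ (τ.mate f) j
  not_opensWithin : ∀ s, γ.mate f < s → s < j → ¬γ.OpensWithin (τ.mate f) s
  one_le_signGap : ∀ x, γ.mate f ≤ x → x < j → 1 ≤ γ.signGap τ (-δ) x

namespace FirstDifference

theorem exists_isPivot_of_signGap_nonpos (h : FirstDifference γ τ f) (hun : Unnested γ τ f)
    (hδ : δ ≠ 0) (hfx₀ : γ.mate f ≤ x₀) (hx₀m : x₀ < τ.mate f) (hx₀ : γ.signGap τ δ x₀ ≤ 0)
    (hinert : ∀ s, γ.mate f < s → s ≤ x₀ → γ.IsInert (τ.mate f) s) :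
    ∃ j, IsPivot γ τ f δ j := by
  have hex : ∃ j, γ.mate f < j ∧ j ≤ τ.mate f ∧ γ.IsPartner δ (τ.mate f) j := by
    by_contra! hno
    exact (h.one_le_signGap hun hδ hfx₀ hx₀m hno).not_gt (by lia)
  obtain ⟨j, hj⟩ := exists_minimal_of_wellFoundedLT _ hex
  obtain ⟨hfj, hjm, hpartner⟩ := hj.prop
  have hfirst : ∀ s, γ.mate f < s → s < j → ¬γ.IsPartner δ (τ.mate f) s := fun s hfs hsj hs =>
    hj.not_prop_of_lt hsj ⟨hfs, hsj.le.trans hjm, hs⟩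
  have hopen : ∀ s, γ.mate f < s → s < j → ¬γ.OpensWithin (τ.mate f) s := fun s hfs hsj hs =>
    hfirst s hfs hsj (.inr hs)
  have hx₀j : x₀ < j := not_le.1 fun hle => (hinert j hfj hle).not_isPartner hδ hpartner
  have hdiag : ∀ x, γ.mate f ≤ x → x < j → 1 ≤ γ.signGap τ δ x + γ.signGap τ (-δ) x :=
    fun x hfx hxj => by
      rw [signGap_add_signGap_neg γ τ hδ]
      exact h.one_le_pairGap_of_unnested hun (h.le_mate.trans hfx) le_rfl hfx (hxj.trans_le hjm)
        fun s hfs hsx => hopen s hfs (hsx.trans_lt hxj)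
  refine ⟨j, hfj, hjm, hpartner, hopen, fun x hfx hxj => ?_⟩
  rcases le_total x₀ x with hle | hle
  · have hmono := h.signGap_le_of_le hun hfx₀ hle (hxj.le.trans hjm) fun s hfs hsx =>
      hfirst s hfs (hsx.trans_lt hxj)
    have := hdiag x hfx hxj
    lia
  · have hmono := h.signGap_le_of_le (δ := -δ) hun hfx hle hx₀m.le fun s hfs hsx =>
      (hinert s hfs hsx).not_isPartner (SignType.neg_eq_zero_iff.not.2 hδ)
    have := hdiag x₀ hfx₀ hx₀j
    lia

theorem exists_isPivot_of_sign (h : FirstDifference γ τ f) (hδ : δ ≠ 0) (hf : γ.sign f = -δ) :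
    ∃ j, IsPivot γ τ f δ j := by
  have hfix := mate_eq_self_of_sign_eq (SignType.neg_eq_zero_iff.not.2 hδ) hf
  refine h.exists_isPivot_of_signGap_nonpos (x₀ := f) (by grind [Unnested]) hδ hfix.le
    (h.le_mate.trans_lt h.mate_lt_mate) ?_ (by grind)
  have hcount : countUpTo (γ.RisesAt δ) f ≤ countUpTo (τ.RisesAt δ) f := by
    refine countUpTo_le_countUpTo fun s hsf hs => ?_
    rcases hsf.lt_or_eq with hlt | rfl
    · rwa [RisesAt, ← (h.agree s hlt).1, ← (h.agree s hlt).2]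
    · exact absurd hs (not_or.2 ⟨fun hs => hδ (SignType.self_eq_neg_iff.1 (hs.symm.trans hf)),
        hfix.not_lt⟩)
  unfold signGap
  lia

theorem exists_isPivot_of_not_isInert (h : FirstDifference γ τ f) (hun : Unnested γ τ f)
    (hex : ∃ s, γ.mate f < s ∧ s ≤ τ.mate f ∧ ¬γ.IsInert (τ.mate f) s) :
    ∃ δ ≠ 0, ∃ j, IsPivot γ τ f δ j := by
  obtain ⟨j, hj⟩ := exists_minimal_of_wellFoundedLT _ hex
  obtain ⟨hfj, hjm, hactive⟩ := hj.prop
  obtain ⟨δ, hδ, hpartner⟩ := exists_isPartner_of_not_isInert hactive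
  have hinert : ∀ s, γ.mate f < s → s < j → γ.IsInert (τ.mate f) s := fun s hfs hsj =>
    by_contra fun hs => hj.not_prop_of_lt hsj ⟨hfs, hsj.le.trans hjm, hs⟩
  by_cases hgap : ∀ x, γ.mate f ≤ x → x < j → 1 ≤ γ.signGap τ (-δ) x
  · exact ⟨δ, hδ, j, hfj, hjm, hpartner, fun s hfs hsj => (hinert s hfs hsj).2, hgap⟩
  · push Not at hgap
    obtain ⟨x₀, hfx₀, hx₀j, hx₀⟩ := hgap
    have hδ' : -δ ≠ 0 := SignType.neg_eq_zero_iff.not.2 hδ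
    exact ⟨-δ, hδ', h.exists_isPivot_of_signGap_nonpos hun hδ' hfx₀ (hx₀j.trans_le hjm) (by lia)
      fun s hfs hsx => hinert s hfs (hsx.trans_lt hx₀j)⟩

theorem exists_move_of_isPivot_of_sign (h : FirstDifference γ τ f) (hδ : δ ≠ 0)
    (hf : γ.sign f = -δ) (hj : IsPivot γ τ f δ j) : ∃ γ', γ < γ' ∧ γ' ≤ τ ∧ Move γ γ' := by
  have hfix := mate_eq_self_of_sign_eq (SignType.neg_eq_zero_iff.not.2 hδ) hf
  obtain ⟨hfj, hjm, hpartner, hopen, hgap⟩ := hj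
  obtain ⟨hsign, hpair⟩ := le_iff_gaps_nonneg.1 h.le
  have hpos : ∀ x y, f ≤ x → x < j → x ≤ y → y < τ.mate f → 1 ≤ γ.pairGap τ x y :=
    fun x y hfx hxj hxy hym => h.one_le_pairGap_of_unnested (by grind [Unnested]) hfx hxy
      (hfix.trans_le (hfx.trans hxy)) hym fun s hfs hsx => hopen s hfs (hsx.trans_lt hxj)
  rw [hfix] at hfj hgap
  rcases hpartner with hj | ⟨hj, hjm'⟩
  · obtain ⟨γ', hmove, hsign', hpair'⟩ := exists_move_sign_neg hδ hfj hf hj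
    exact hmove.exists_of_gap_le (by grind) (by grind)
  · obtain ⟨γ', hmove, hsign', hpair'⟩ := exists_move_sign_pair hδ hfj hj hf rfl
    exact hmove.exists_of_gap_le (by grind) (by grind)

theorem exists_move_of_isPivot_of_lt (h : FirstDifference γ τ f) (hun : Unnested γ τ f)
    (hδ : δ ≠ 0) (hf : f < γ.mate f) (hj : IsPivot γ τ f δ j) :
    ∃ γ', γ < γ' ∧ γ' ≤ τ ∧ Move γ γ' := by
  obtain ⟨hfj, hjm, hpartner, hopen, hgap⟩ := hj
  obtain ⟨hsign, hpair⟩ := le_iff_gaps_nonneg.1 h.le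
  have hpos : ∀ x y, f ≤ x → x < j → x ≤ y → γ.mate f ≤ y → y < τ.mate f → 1 ≤ γ.pairGap τ x y :=
    fun x y hfx hxj hxy hfy hym => h.one_le_pairGap_of_unnested hun hfx hxy hfy hym
      fun s hfs hsx => hopen s hfs (hsx.trans_lt hxj)
  rcases hpartner with hj | ⟨hj, hjm'⟩
  · obtain ⟨γ', hmove, hsign', hpair'⟩ := exists_move_pair_sign hδ hf hfj rfl hj
    exact hmove.exists_of_gap_le (by grind) (by grind)
  · obtain ⟨γ', hmove, hsign', hpair'⟩ := exists_move_join hδ hf hfj hj rfl rfl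
    exact hmove.exists_of_gap_le (by grind) (by grind)

theorem exists_move_of_not_unnested (h : FirstDifference γ τ f) (hun : ¬Unnested γ τ f) :
    ∃ γ', γ < γ' ∧ γ' ≤ τ ∧ Move γ γ' := by
  have hex : ∃ s, f < s ∧ s < γ.mate f ∧ γ.mate f < γ.mate s ∧ γ.mate s ≤ τ.mate f := by
    simpa [Unnested] using hun
  obtain ⟨s, hs⟩ := exists_minimal_of_wellFoundedLT _ hex
  obtain ⟨hfs, hsa, has, hsm⟩ := hs.prop
  obtain ⟨hsign, hpair⟩ := le_iff_gaps_nonneg.1 h.le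
  have hpos : ∀ x y, f ≤ x → x < s → x ≤ y → γ.mate f ≤ y → y < γ.mate s →
      1 ≤ γ.pairGap τ x y := fun x y hfx hxs hxy hfy hys =>
    h.one_le_pairGap hfx hxy hfy (hys.trans_le hsm) fun t hft htx hyt => not_le.1 fun htm =>
      hs.not_prop_of_lt (htx.trans_lt hxs)
        ⟨hft, htx.trans_lt (hxs.trans hsa), hfy.trans_lt hyt, htm⟩
  obtain ⟨γ', hmove, hsign', hpair'⟩ := exists_move_nest hfs hsa has rfl rfl
  exact hmove.exists_of_gap_le (by grind) (by grind)

theorem lt_mate_of_isInert (h : FirstDifference γ τ f) (hun : Unnested γ τ f)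
    (hinert : ∀ s, γ.mate f < s → s ≤ τ.mate f → γ.IsInert (τ.mate f) s)
    (hfx : γ.mate f < x) (hxm : x ≤ τ.mate f) (hx : f ≤ τ.mate x) : τ.mate f < γ.mate x := by
  obtain ⟨hsign, hopen⟩ := hinert x hfx hxm
  rcases (sign_eq_zero_iff.1 hsign).lt_or_gt with hlt | hgt
  · have hearly := h.mate_lt_of_mate_lt_self hun hfx hxm hlt fun s hfs hsx =>
      (hinert s hfs (hsx.le.trans hxm)).2
    exact absurd hearly (h.mate_eq_of_mate_lt hearly ▸ hx).not_gt
  · exact not_le.1 fun hle => hopen ⟨hgt, hle⟩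

theorem two_le_pairGap_of_isInert (h : FirstDifference γ τ f) (hun : Unnested γ τ f)
    (hinert : ∀ s, γ.mate f < s → s ≤ τ.mate f → γ.IsInert (τ.mate f) s)
    (hfx : γ.mate f ≤ x) (hxy : x ≤ y) (hym : y < τ.mate f) : 2 ≤ γ.pairGap τ x y := by
  have hsign : ∀ δ ≠ 0, 1 ≤ γ.signGap τ δ y := fun δ hδ =>
    h.one_le_signGap hun hδ (hfx.trans hxy) hym fun s hfs hsm => (hinert s hfs hsm).not_isPartner hδ
  have hle : γ.pairGap τ y y ≤ γ.pairGap τ x y :=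
    countUpTo_sub_le_of_le hxy fun s hxs hsy hs => hym.trans <|
      h.lt_mate_of_isInert hun hinert (hfx.trans_lt hxs) (hsy.trans hym.le)
        ((h.le_mate.trans (hfx.trans hxy)).trans hs.le)
  have hdiag := signGap_add_signGap_neg γ τ (δ := 1) (by decide) y
  have hplus := hsign 1 (by decide)
  have hminus := hsign (-1) (by decide)
  lia

theorem one_le_pairGap_of_mate_le (h : FirstDifference γ τ f) (hun : Unnested γ τ f)
    (hinert : ∀ s, γ.mate f < s → s ≤ τ.mate f → γ.IsInert (τ.mate f) s)
    (hfx : γ.mate f ≤ x) (hxm : x < τ.mate f) (hmy : τ.mate f ≤ y)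
    (hout : ∀ s, x < s → s ≤ τ.mate f → τ.mate f < γ.mate s → y < γ.mate s) :
    1 ≤ γ.pairGap τ x y := by
  have hτm := τ.mate_mate f
  have hfm := h.le_mate.trans h.mate_lt_mate.le
  have hlt : γ.pairGap τ (τ.mate f) y < γ.pairGap τ x y :=
    countUpTo_sub_lt_of_le (fun s hxs hsm hs => hout s hxs hsm <| h.lt_mate_of_isInert hun hinert
        (hfx.trans_lt hxs) hsm ((hfm.trans hmy).trans hs.le)) hxm le_rfl
      (hτm.symm ▸ (hfm.trans hmy).not_gt)
      (hout _ hxm le_rfl <| h.lt_mate_of_isInert hun hinert h.mate_lt_mate le_rfl hτm.ge)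
  have hnonneg := (le_iff_gaps_nonneg.1 h.le).2 _ _ hmy
  lia

theorem exists_first_mate_of_isInert (h : FirstDifference γ τ f) (hun : Unnested γ τ f)
    (hinert : ∀ s, γ.mate f < s → s ≤ τ.mate f → γ.IsInert (τ.mate f) s) :
    ∃ k, γ.mate f < k ∧ k ≤ τ.mate f ∧ τ.mate f < γ.mate k ∧
      ∀ s, γ.mate f < s → s ≤ τ.mate f → τ.mate f < γ.mate s → γ.mate k ≤ γ.mate s := by
  have hτm := h.lt_mate_of_isInert hun hinert h.mate_lt_mate le_rfl (τ.mate_mate f).ge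
  obtain ⟨k, hk⟩ := exists_minimalFor_of_wellFoundedLT
    (fun s => γ.mate f < s ∧ s ≤ τ.mate f ∧ τ.mate f < γ.mate s) γ.mate
    ⟨τ.mate f, h.mate_lt_mate, le_rfl, hτm⟩
  obtain ⟨hfk, hkm, hk'⟩ := hk.prop
  exact ⟨k, hfk, hkm, hk', fun s hfs hsm hs => not_lt.1 fun hlt =>
    hk.not_prop_of_lt hlt ⟨hfs, hsm, hs⟩⟩

theorem exists_move_of_isInert (h : FirstDifference γ τ f) (hun : Unnested γ τ f)
    (hf : f < γ.mate f)
    (hinert : ∀ s, γ.mate f < s → s ≤ τ.mate f → γ.IsInert (τ.mate f) s) :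
    ∃ γ', γ < γ' ∧ γ' ≤ τ ∧ Move γ γ' := by
  obtain ⟨k, hfk, hkm, hk, hfirst⟩ := h.exists_first_mate_of_isInert hun hinert
  obtain ⟨hsign, hpair⟩ := le_iff_gaps_nonneg.1 h.le
  have hgap : ∀ δ ≠ 0, ∀ x, γ.mate f ≤ x → x < k → 1 ≤ γ.signGap τ δ x := fun δ hδ x hfx hxk =>
    h.one_le_signGap hun hδ hfx (hxk.trans_le hkm) fun s hfs hsm =>
      (hinert s hfs hsm).not_isPartner hδ
  have hleft : ∀ x y, f ≤ x → x ≤ y → γ.mate f ≤ y → y < k → 1 ≤ γ.pairGap τ x y :=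
    fun x y hfx hxy hfy hyk => h.one_le_pairGap_of_unnested hun hfx hxy hfy (hyk.trans_le hkm)
      fun s hfs hsx => (hinert s hfs (hsx.trans (hxy.trans (hyk.le.trans hkm)))).2
  have hinner : ∀ x y, γ.mate f ≤ x → x ≤ y → y < τ.mate f → 2 ≤ γ.pairGap τ x y :=
    fun x y => h.two_le_pairGap_of_isInert hun hinert
  have houter : ∀ x y, γ.mate f ≤ x → x < k → τ.mate f ≤ y → y < γ.mate k →
      1 ≤ γ.pairGap τ x y := fun x y hfx hxk hmy hyk =>
    h.one_le_pairGap_of_mate_le hun hinert hfx (hxk.trans_le hkm) hmy fun s hxs hsm hs =>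
      hyk.trans_le (hfirst s (hfx.trans_lt hxs) hsm hs)
  obtain ⟨γ', hmove, hsign', hpair'⟩ := exists_move_cross hf hfk (hkm.trans_lt hk) rfl rfl
  refine hmove.exists_of_gap_le (fun δ hδ x => ?_) fun x y hxy => ?_
  · rw [hsign' δ hδ]
    split_ifs with hx
    exacts [⟨zero_le_one, hgap δ hδ x hx.1 hx.2⟩, ⟨le_rfl, hsign δ hδ x⟩]
  · rw [hpair' x y hxy]
    split_ifs with hl hr hr
    · exact ⟨by lia, hinner x y hr.1 hxy (hl.2.2.trans_le hkm)⟩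
    · exact ⟨by lia, hleft x y hl.1 hxy hl.2.1 hl.2.2⟩
    · rcases lt_or_ge y (τ.mate f) with hym | hmy
      · exact ⟨by lia, one_le_two.trans (hinner x y hr.1 hxy hym)⟩
      · exact ⟨by lia, houter x y hr.1 hr.2.1 hmy hr.2.2⟩
    · exact ⟨le_rfl, hpair x y hxy⟩

end FirstDifference

end Clan

theorem mainTheorem3 (p q : ℕ) (γ τ : Clan p q) (hγτ : γ < τ) :
    ∃ γ' : Clan p q, γ < γ' ∧ γ' ≤ τ ∧ Clan.Move γ γ' := by
  obtain ⟨f, hf⟩ := Clan.exists_firstDifference hγτ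
  rcases hf.le_mate.eq_or_lt with hfix | hopen
  · have hsign : γ.sign f ≠ 0 := (γ.sign_ne_zero_iff f).2 hfix.symm
    have hδ : -γ.sign f ≠ 0 := SignType.neg_eq_zero_iff.not.2 hsign
    have hneg : γ.sign f = - -γ.sign f := (neg_neg _).symm
    obtain ⟨j, hj⟩ := hf.exists_isPivot_of_sign hδ hneg
    exact hf.exists_move_of_isPivot_of_sign hδ hneg hj
  by_cases hun : Clan.Unnested γ τ f
  · by_cases hinert : ∀ s, γ.mate f < s → s ≤ τ.mate f → γ.IsInert (τ.mate f) s
    · exact hf.exists_move_of_isInert hun hopen hinert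
    · push Not at hinert
      obtain ⟨δ, hδ, j, hj⟩ := hf.exists_isPivot_of_not_isInert hun hinert
      exact hf.exists_move_of_isPivot_of_lt hun hδ hopen hj
  · exact hf.exists_move_of_not_unnested hun
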